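/- Let $N$ agents be given. Agent $i$ has a countable state space $S_i$, in each state $s$ a finite set $A_i(s)$ of admissible actions, containing a distinguished crowded action $a_{\rm crowd}$ and at least one other action, a transition kernel $p_i(\cdot\mid s,a)$, a bounded local reward $u_i(s,a)$ and an initial law $\beta_i$. Let $\gamma\in[0,1)$ and let $d:[1,\infty)\to\mathbb R$ be differentiable with $d'>0$. For $\theta\in\mathbb R^N$ put $\theta_{-i}=\sum_{k\neq i}\theta_k$, $c_i(s,a)=\mathbf 1[a=a_{\rm crowd}]$ and $\hat r_i(s,a;\theta_{-i})=u_i(s,a)+c_i(s,a)\,d(1+\theta_{-i})$. For a stationary randomized policy $\pi$ of agent $i$ let $$J_i(\pi;\theta_{-i})=\mathbb E_{\pi,\beta_i}\Big[\sum_{t\ge0}\gamma^t\hat r_i(s_t,a_t;\theta_{-i})\Big],\qquad K_i(\pi)=\mathbb E_{\pi,\beta_i}\Big[\sum_{t\ge0}\gamma^t c_i(s_t,a_t)\Big],$$ the latter being the discounted frequency with which $\pi$ uses the crowded action. Let $\tilde J_i(\theta)=\inf\{J_i(\pi;\theta_{-i}): K_i(\pi)\le\theta_i\}$. Let $M=\theta_{\max}>0$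 be any constant, and normalize the constraint as $K_i(\pi)/M\le\theta_i/M$, so that the Lagrangian is $$\mathcal L_i(\pi,\lambda;\theta)=J_i(\pi;\theta_{-i})+\lambda\Big(\frac{K_i(\pi)}M-\frac{\theta_i}M\Big).$$ An optimal policy $\pi^\star$ is a minimizer of the constrained problem; an optimal multiplier $\lambda^\star$ is a maximizer of $\lambda\mapsto\inf_\pi\mathcal L_i(\pi,\lambda;\theta)$ over $\lambda\ge0$. Then for Lebesgue-almost every $\theta\in(0,M)^N$ and every agent $i$, an optimal policy and an optimal multiplier exist, and for every optimal policy $\pi^\star$ and every optimal multiplier $\lambda^\star$ of agent $i$ at $\theta$ one has $\tilde J_i(\theta)=\mathcal L_i(\pi^\star,\lambda^\star;\theta)$, and: 1. $\tilde J_i$ has a partial derivative with respect to $\theta_i$ at $\theta$, and $\dfrac{\partial\tilde J_i}{\partial\theta_i}(\theta)=-\dfrac{\lambda^\star}{M}\le0$; 2. for every $j\ne i$, $\tilde J_i$ has a partial derivative with respect to $\theta_j$ at $\theta$, and $\dfrac{\partial\tilde J_i}{\partial\theta_j}(\theta)=K_i(\pi^\star)\,\dfrac{\partial}{\partial\theta_j}d(1+\theta_{-i})\ge0$.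 Whenever the constraint parameter $\theta_i$ is the frequency with which agent $i$ uses the crowded action, i.e. $K_i(\pi^\star)=\theta_i$, and in particular whenever $\lambda^\star>0$, this reads $$\frac{\partial\tilde J_i}{\partial\theta_j}(\theta)=\theta_i\,\frac{\partial}{\partial\theta_j}d(1+\theta_{-i})\ge0 .$$ -/

import Mathlib

noncomputable section

namespace CrowdCMDP

/-- The local decision model of one agent: a countable-state controlled Markov chain with finitely
many admissible actions in each state, one of which is the crowded action, and in every state at
least one admissible action that is not crowded. -/
structure LocalModel (S A : Type*) where
  /-- the admissible actions in a state -/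
  avail : S → Finset A
  /-- the crowded action -/
  crowd : A
  crowd_mem : ∀ s, crowd ∈ avail s
  exists_other : ∀ s, ∃ a ∈ avail s, a ≠ crowd
  /-- the transition kernel -/
  trans : S → A → PMF S
  /-- the local part of the immediate reward (a quantity to be minimized) -/
  utility : S → A → ℝ
  utility_bdd : ∃ C : ℝ, ∀ s, ∀ a ∈ avail s, |utility s a| ≤ C
  /-- the law of the initial state -/
  init : PMF S

namespace LocalModel

variable {S A : Type*} (m : LocalModel S A)

/-- Stationary randomized policies using only admissible actions. -/
def Policy : Type _ :=
  {π : S → PMF A // ∀ s, ∀ a ∈ (π s).support, a ∈ m.avail s}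

variable {m}

/-- The law of the state at time `t` under the policy `π`. -/
def stateLaw (π : m.Policy) : ℕ → PMF S
  | 0 => m.init
  | t + 1 => (stateLaw π t).bind fun s => (π.1 s).bind fun a => m.trans s a

/-- The joint law of the state and the action at time `t` under the policy `π`. -/
def pairLaw (π : m.Policy) (t : ℕ) : PMF (S × A) :=
  (stateLaw π t).bind fun s => (π.1 s).map fun a => (s, a)

/-- `E_π [ ∑ₜ γ ^ t * f (sₜ, aₜ) ]`, the expected discounted sum of `f` under the policy `π`. -/
def discounted (γ : ℝ) (π : m.Policy) (f : S → A → ℝ) : ℝ :=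
  ∑' t : ℕ, γ ^ t * ∑' x : S × A, (pairLaw π t x).toReal * f x.1 x.2

variable (m)

open Classical in
/-- The immediate cost: one when the crowded action is used, zero otherwise. -/
def cost (_s : S) (a : A) : ℝ := if a = m.crowd then 1 else 0

/-- The approximated immediate reward `u(s, a) + 1[a = crowd] * d(1 + x)`, where `x` is the sum of
the constraint parameters of the other agents. -/
def reward (d : ℝ → ℝ) (x : ℝ) (s : S) (a : A) : ℝ :=
  m.utility s a + m.cost s a * d (1 + x)

variable {m}

/-- The discounted reward of a policy. -/
def J (γ : ℝ) (d : ℝ → ℝ) (x : ℝ) (π : m.Policy) : ℝ := discounted γ π (m.reward d x)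

/-- The discounted cost of a policy: its discounted frequency of use of the crowded action. -/
def K (γ : ℝ) (π : m.Policy) : ℝ := discounted γ π m.cost

end LocalModel

section Agents

variable {N : ℕ} {S A : Fin N → Type*} (m : ∀ i, LocalModel (S i) (A i))
  (γ : ℝ) (d : ℝ → ℝ) (M : ℝ)

/-- The sum of the constraint parameters of the agents other than `i`. -/
def others (i : Fin N) (θ : Fin N → ℝ) : ℝ := ∑ k ∈ Finset.univ.erase i, θ k

/-- The optimal value of the constrained problem of agent `i`: minimize the discounted reward
over the policies whose discounted cost is at most `θ i`. -/
def value (i : Fin N) (θ : Fin N → ℝ) : ℝ :=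
  sInf {v | ∃ π : (m i).Policy, LocalModel.K γ π ≤ θ i ∧ v = LocalModel.J γ d (others i θ) π}

/-- A policy that is feasible and minimizes the discounted reward among the feasible policies. -/
def IsOptimalPolicy (i : Fin N) (θ : Fin N → ℝ) (π : (m i).Policy) : Prop :=
  LocalModel.K γ π ≤ θ i ∧ ∀ π' : (m i).Policy, LocalModel.K γ π' ≤ θ i →
    LocalModel.J γ d (others i θ) π ≤ LocalModel.J γ d (others i θ) π'

/-- The Lagrangian of agent `i`, for the constraint normalized by the constant `M`. -/
def lagrangian (i : Fin N) (θ : Fin N → ℝ) (π : (m i).Policy) (l : ℝ) : ℝ :=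
  LocalModel.J γ d (others i θ) π + l * (LocalModel.K γ π / M - θ i / M)

/-- The dual function of agent `i`. -/
def dual (i : Fin N) (θ : Fin N → ℝ) (l : ℝ) : ℝ :=
  ⨅ π : (m i).Policy, lagrangian m γ d M i θ π l

/-- An optimal Lagrange multiplier: a maximizer of the dual function over `l ≥ 0`. -/
def IsOptimalMultiplier (i : Fin N) (θ : Fin N → ℝ) (l : ℝ) : Prop :=
  0 ≤ l ∧ ∀ l', 0 ≤ l' → dual m γ d M i θ l' ≤ dual m γ d M i θ l

/-- The partial derivative of `θ ↦ d (1 + θ_{-i})` with respect to `θ j`. -/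
def partialPenalty (i j : Fin N) (θ : Fin N → ℝ) : ℝ :=
  deriv (fun t => d (1 + others i (Function.update θ j t))) (θ j)

end Agents

end CrowdCMDP

end

/-! Write `U` for the discounted utility and `K` for the discounted crowded use of a policy. The
other agents enter only through the price `y = d (1 + others i θ)`, so the value is V(c, y) = min {U
+ y K : K ≤ c} at c = θ i. A multiplier `l` just raises the price: with G(z) = inf (U + z K), the
dual function is G(y + l / M) - (l / M) c. Everything is read off from the concave function G.

Mixtures of discounted occupation measures are again occupation measures, so V is convex in c.
Compactness of the set of admissible kernels and lower semicontinuity give minimizers. A subgradient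
of V(·, y) at c is minus a multiplier closing the duality gap (`of_subgradient`), which yields
strong duality.

Derivative in c: if the multiplier is unique, so is the subgradient, and V(·, y) is differentiable.
Two multipliers would make G affine with slope c on an interval. That interval contains a rational,
so the bad levels c form a countable set that does not depend on y (`multiplier_unique`).

Derivative in y: an optimal policy π gives the upper line U π + y K π, touching V(c, ·) at the
current price. If the multiplier is positive, slackness forces K π = c and weak duality gives a
touching lower line of the same slope. If it is zero, G itself touches from below, and G is
differentiable off countably many prices (`hasDerivAt_price`).

Since d is injective on [1, ∞), the excluded θ with positive coordinates lie in countably many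
hyperplanes, a null set. -/

/-! ### Convex functions of one real variable -/

open Set in
theorem HasDerivWithinAt.hasDerivAt_of_Iio_of_Ioi {f : ℝ → ℝ} {a x : ℝ}
    (hl : HasDerivWithinAt f a (Iio x) x) (hr : HasDerivWithinAt f a (Ioi x) x) :
    HasDerivAt f a x := by
  rw [hasDerivWithinAt_Iio_iff_Iic] at hl
  rw [hasDerivWithinAt_Ioi_iff_Ici] at hr
  simpa [Iic_union_Ici] using hl.union hr

-- The right derivative is monotone, hence continuous off a countable set. At a continuity point,
-- squeezing slopes from the left forces the right derivative below the left one.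
open Set in
theorem ConvexOn.countable_not_differentiableAt {f : ℝ → ℝ} (hf : ConvexOn ℝ univ f) :
    {x | ¬ DifferentiableAt ℝ f x}.Countable := by
  have hmono : Monotone (fun x => derivWithin f (Ioi x) x) := by
    have h := hf.monotoneOn_rightDeriv
    rwa [interior_univ, monotoneOn_univ] at h
  have hint : ∀ x : ℝ, x ∈ interior (univ : Set ℝ) := by simp
  refine hmono.countable_not_continuousAt.mono fun x (hx : ¬ DifferentiableAt ℝ f x) => ?_
  refine fun hc => hx ?_
  have hle : derivWithin f (Ioi x) x ≤ derivWithin f (Iio x) x := by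
    refine le_of_tendsto (hc.tendsto.mono_left (nhdsWithin_le_nhds (s := Iio x))) ?_
    filter_upwards [self_mem_nhdsWithin] with w hw
    exact (hf.rightDeriv_le_slope_of_mem_interior (hint w) (mem_univ x) hw).trans
      (hf.slope_le_leftDeriv_of_mem_interior (mem_univ w) (hint x) hw)
  have heq := le_antisymm hle (hf.leftDeriv_le_rightDeriv_of_mem_interior (hint x))
  have h1 := hf.hasDerivWithinAt_rightDeriv_of_mem_interior (hint x)
  have h2 := hf.hasDerivWithinAt_leftDeriv_of_mem_interior (hint x)
  rw [heq] at h1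
  exact (h2.hasDerivAt_of_Iio_of_Ioi h1).differentiableAt

-- Every number between the left and the right derivative is a subgradient, so uniqueness makes the
-- two coincide.
open Set in
theorem ConvexOn.hasDerivAt_of_subgradient_unique {f : ℝ → ℝ} {D : Set ℝ} (hf : ConvexOn ℝ D f)
    {x s : ℝ} (hx : x ∈ interior D)
    (hs : ∀ t, (∀ y ∈ D, f x + t * (y - x) ≤ f y) → t = s) : HasDerivAt f s x := by
  have hlr := hf.leftDeriv_le_rightDeriv_of_mem_interior hx
  have key : ∀ t, derivWithin f (Iio x) x ≤ t → t ≤ derivWithin f (Ioi x) x → t = s := by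
    refine fun t h1 h2 => hs t fun y hy => ?_
    rcases lt_trichotomy y x with h | rfl | h
    · have := (hf.slope_le_leftDeriv_of_mem_interior hy hx h).trans h1
      rw [slope_def_field, div_le_iff₀ (sub_pos.2 h)] at this
      linarith
    · simp
    · have := h2.trans (hf.rightDeriv_le_slope_of_mem_interior hx hy h)
      rw [slope_def_field, le_div_iff₀ (sub_pos.2 h)] at this
      linarith
  have h1 := hf.hasDerivWithinAt_rightDeriv_of_mem_interior hx
  have h2 := hf.hasDerivWithinAt_leftDeriv_of_mem_interior hx
  rw [key _ hlr le_rfl] at h1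
  rw [key _ le_rfl hlr] at h2
  exact h2.hasDerivAt_of_Iio_of_Ioi h1

-- Without subgradients the uniqueness criterion would hold vacuously for every slope, giving both 0
-- and 1 as derivatives.
open Set in
theorem ConvexOn.exists_subgradient {f : ℝ → ℝ} {D : Set ℝ} (hf : ConvexOn ℝ D f)
    {x : ℝ} (hx : x ∈ interior D) : ∃ t, ∀ y ∈ D, f x + t * (y - x) ≤ f y := by
  by_contra! h
  have key : ∀ s, HasDerivAt f s x := fun s =>
    hf.hasDerivAt_of_subgradient_unique hx fun t ht => by
      obtain ⟨y, hy, hlt⟩ := h t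
      exact absurd (ht y hy) hlt.not_ge
  exact zero_ne_one ((key 0).unique (key 1))

/-- A function squeezed between two functions with a common derivative and value. -/
theorem HasDerivAt.of_squeeze {f l u : ℝ → ℝ} {a x : ℝ} (hl : HasDerivAt l a x)
    (hu : HasDerivAt u a x) (hlf : ∀ᶠ y in nhds x, l y ≤ f y) (hfu : ∀ᶠ y in nhds x, f y ≤ u y)
    (hlx : l x = f x) (hux : u x = f x) : HasDerivAt f a x := by
  rw [hasDerivAt_iff_isLittleO] at *
  have h := hl.norm_left.add hu.norm_left
  refine Asymptotics.IsBigO.trans_isLittleO (Asymptotics.IsBigO.of_bound 1 ?_) h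
  filter_upwards [hlf, hfu] with y h1 h2
  rw [one_mul, hlx, hux]
  simp only [smul_eq_mul, Real.norm_eq_abs]
  rw [abs_of_nonneg (by positivity : 0 ≤ |l y - f x - (y - x) * a| + |u y - f x - (y - x) * a|)]
  rw [abs_le]
  have e1 := neg_abs_le (l y - f x - (y - x) * a)
  have e2 := le_abs_self (u y - f x - (y - x) * a)
  have e3 := abs_nonneg (l y - f x - (y - x) * a)
  have e4 := abs_nonneg (u y - f x - (y - x) * a)
  constructor <;> linarith

/-- If two functions agree at a point, one dominates the other, and both are differentiable there,
the derivatives agree. -/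
theorem HasDerivAt.eq_of_le {l u : ℝ → ℝ} {a b x : ℝ} (hl : HasDerivAt l a x)
    (hu : HasDerivAt u b x) (h : ∀ y, l y ≤ u y) (hx : l x = u x) : a = b := by
  have hm : IsLocalMin (fun y => u y - l y) x :=
    Filter.Eventually.of_forall fun y => by
      have := h y
      simp only [hx]
      linarith
  have := hm.hasDerivAt_eq_zero (hu.sub hl)
  linarith

/-! ### Duality and sensitivity for an abstract convex program -/

namespace CrowdCMDP

/-- A minimization problem with a single constraint, whose pairs (objective, constraint value) form
a bounded convex set containing a point of constraint value zero, and whose minima are attained. -/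
structure IsConvexProgram {P : Type*} (U K : P → ℝ) : Prop where
  bdd : ∃ B, ∀ π, |U π| ≤ B ∧ K π ≤ B
  nonneg : ∀ π, 0 ≤ K π
  exists_zero : ∃ π, K π = 0
  mix : ∀ π₁ π₂, ∀ w : ℝ, 0 ≤ w → w ≤ 1 →
    ∃ π, U π = w * U π₁ + (1 - w) * U π₂ ∧ K π = w * K π₁ + (1 - w) * K π₂
  attained : ∀ c, 0 ≤ c → ∀ y : ℝ,
    ∃ π, K π ≤ c ∧ ∀ π', K π' ≤ c → U π + y * K π ≤ U π' + y * K π'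

/-- The optimal value with the constraint level `c` and the price `y`. -/
noncomputable def optVal {P : Type*} (U K : P → ℝ) (c y : ℝ) : ℝ := sInf {v | ∃ π, K π ≤ c ∧ v = U π + y * K π}

/-- The optimal value of the unconstrained problem with the price `z`. -/
noncomputable def freeVal {P : Type*} (U K : P → ℝ) (z : ℝ) : ℝ := ⨅ π, U π + z * K π

namespace IsConvexProgram

variable {P : Type*} {U K : P → ℝ} (h : IsConvexProgram U K)

include h

theorem bddBelow (z : ℝ) : BddBelow (Set.range fun π => U π + z * K π) := by
  obtain ⟨B, hB⟩ := h.bdd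
  refine ⟨-B - |z| * B, ?_⟩
  rintro _ ⟨π, rfl⟩
  have h1 := (abs_le.1 (hB π).1).1
  have h2 : |z * K π| ≤ |z| * B := by
    rw [abs_mul, abs_of_nonneg (h.nonneg π)]
    exact mul_le_mul_of_nonneg_left (hB π).2 (abs_nonneg z)
  have h3 := neg_abs_le (z * K π)
  simp only
  linarith

theorem nonempty : Nonempty P := ⟨h.exists_zero.choose⟩

theorem freeVal_le (z : ℝ) (π : P) : freeVal U K z ≤ U π + z * K π := ciInf_le (h.bddBelow z) π

theorem le_freeVal {z v : ℝ} (hv : ∀ π, v ≤ U π + z * K π) : v ≤ freeVal U K z :=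
  have := h.nonempty
  le_ciInf hv

theorem convexOn_neg_freeVal : ConvexOn ℝ Set.univ fun z => -freeVal U K z := by
  refine ⟨convex_univ, fun x _ y _ a b ha hb hab => ?_⟩
  simp only [smul_eq_mul]
  have : a * freeVal U K x + b * freeVal U K y ≤ freeVal U K (a * x + b * y) := by
    refine h.le_freeVal fun π => ?_
    have h1 := mul_le_mul_of_nonneg_left (h.freeVal_le x π) ha
    have h2 := mul_le_mul_of_nonneg_left (h.freeVal_le y π) hb
    have h3 : U π = a * U π + b * U π := by rw [← add_mul, hab, one_mul]
    linarith
  linarith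

theorem optVal_le {c y : ℝ} {π : P} (hπ : K π ≤ c) : optVal U K c y ≤ U π + y * K π := by
  refine csInf_le ((h.bddBelow y).mono ?_) ⟨π, hπ, rfl⟩
  rintro _ ⟨π, -, rfl⟩
  exact ⟨π, rfl⟩

omit h in
theorem optVal_eq {c y : ℝ} {π : P} (hπ : K π ≤ c)
    (hmin : ∀ π', K π' ≤ c → U π + y * K π ≤ U π' + y * K π') :
    optVal U K c y = U π + y * K π :=
  IsLeast.csInf_eq ⟨⟨π, hπ, rfl⟩, by rintro _ ⟨π', h', rfl⟩; exact hmin π' h'⟩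

theorem exists_eq_optVal {c : ℝ} (hc : 0 ≤ c) (y : ℝ) :
    ∃ π, K π ≤ c ∧ optVal U K c y = U π + y * K π := by
  obtain ⟨π, h1, h2⟩ := h.attained c hc y
  exact ⟨π, h1, optVal_eq h1 h2⟩

/-- The mixture of minimizers at two levels is feasible at the mixed level. -/
theorem convexOn_optVal (y : ℝ) : ConvexOn ℝ (Set.Ici 0) fun c => optVal U K c y := by
  refine ⟨convex_Ici 0, fun c₁ h₁ c₂ h₂ a b ha hb hab => ?_⟩
  obtain ⟨π₁, k₁, e₁⟩ := h.exists_eq_optVal h₁ y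
  obtain ⟨π₂, k₂, e₂⟩ := h.exists_eq_optVal h₂ y
  obtain ⟨π, hU, hK⟩ := h.mix π₁ π₂ a ha (by linarith)
  obtain rfl : b = 1 - a := by linarith
  simp only [smul_eq_mul, e₁, e₂]
  have hk : K π ≤ a * c₁ + (1 - a) * c₂ := by
    rw [hK]
    exact add_le_add (mul_le_mul_of_nonneg_left k₁ ha) (mul_le_mul_of_nonneg_left k₂ hb)
  refine (h.optVal_le hk).trans (le_of_eq ?_)
  rw [hU, hK]
  ring

/-- Weak duality. -/
theorem freeVal_sub_le_optVal {c y l : ℝ} (hc : 0 ≤ c) (hl : 0 ≤ l) :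
    freeVal U K (y + l) - l * c ≤ optVal U K c y := by
  obtain ⟨π, k, e⟩ := h.exists_eq_optVal hc y
  have h1 := h.freeVal_le (y + l) π
  have h2 := mul_le_mul_of_nonneg_left k hl
  rw [e]
  linarith

/-- The negative of a subgradient of the optimal value in the constraint level closes the duality
gap. -/
theorem of_subgradient {c y t : ℝ} (hc : 0 ≤ c)
    (ht : ∀ c' ∈ Set.Ici (0 : ℝ), optVal U K c y + t * (c' - c) ≤ optVal U K c' y) :
    0 ≤ -t ∧ freeVal U K (y + -t) - -t * c = optVal U K c y := by
  have h0 : 0 ≤ -t := by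
    obtain ⟨π, k, e⟩ := h.exists_eq_optVal hc y
    -- Relaxing the constraint cannot raise the value, so `t ≤ 0`; any level above `c` would do.
    have h1 := ht (c + 1) (by simp only [Set.mem_Ici]; linarith)
    have h2 : optVal U K (c + 1) y ≤ U π + y * K π := h.optVal_le (by linarith)
    linarith
  refine ⟨h0, le_antisymm (h.freeVal_sub_le_optVal hc h0) ?_⟩
  have : optVal U K c y + -t * c ≤ freeVal U K (y + -t) := by
    refine h.le_freeVal fun π => ?_
    -- Each policy is tested at its own constraint level, where it is feasible.
    have h1 := ht (K π) (h.nonneg π)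
    have h2 : optVal U K (K π) y ≤ U π + y * K π := h.optVal_le le_rfl
    linarith
  linarith

/-- Strong duality. -/
theorem exists_multiplier {c : ℝ} (hc : 0 < c) (y : ℝ) :
    ∃ l, 0 ≤ l ∧ freeVal U K (y + l) - l * c = optVal U K c y := by
  obtain ⟨t, ht⟩ := (h.convexOn_optVal y).exists_subgradient (x := c) (by simpa using hc)
  exact ⟨-t, h.of_subgradient hc.le ht⟩

/-- Complementary slackness. -/
theorem complementary {c y l : ℝ} {π : P} (hl : 0 ≤ l) (hπ : K π ≤ c)
    (hopt : optVal U K c y = U π + y * K π)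
    (hdual : freeVal U K (y + l) - l * c = optVal U K c y) : l * (K π - c) = 0 := by
  have h1 := h.freeVal_le (y + l) π
  have h2 := mul_le_mul_of_nonneg_left hπ hl
  linarith

/-- The slopes of the affine pieces of `freeVal` form a countable set; at a constraint level
outside it the optimal multiplier is unique. -/
theorem multiplier_unique {c y l₁ l₂ : ℝ} (hc : 0 ≤ c)
    (hcs : c ∉ Set.range fun q : ℚ => deriv (freeVal U K) q) (hl₁ : 0 ≤ l₁) (hl₂ : 0 ≤ l₂)
    (h₁ : freeVal U K (y + l₁) - l₁ * c = optVal U K c y)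
    (h₂ : freeVal U K (y + l₂) - l₂ * c = optVal U K c y) : l₁ = l₂ := by
  wlog hlt : l₁ < l₂ generalizing l₁ l₂
  · rcases (not_lt.1 hlt).eq_or_lt with h' | h'
    · exact h'.symm
    · exact (this hl₂ hl₁ h₂ h₁ h').symm
  exfalso
  -- Weak duality puts `freeVal` below this line, and concavity puts it above since both endpoints
  -- lie on the line.
  have hflat : ∀ l ∈ Set.Icc l₁ l₂, freeVal U K (y + l) = optVal U K c y + l * c := by
    rintro l ⟨ha, hb⟩
    have hup := h.freeVal_sub_le_optVal (y := y) hc (hl₁.trans ha)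
    have hd : 0 < l₂ - l₁ := sub_pos.2 hlt
    have hconv := h.convexOn_neg_freeVal.2 (Set.mem_univ (y + l₁)) (Set.mem_univ (y + l₂))
      (div_nonneg (sub_nonneg.2 hb) hd.le) (div_nonneg (sub_nonneg.2 ha) hd.le)
      (by field_simp; ring)
    simp only [smul_eq_mul] at hconv
    rw [show (l₂ - l) / (l₂ - l₁) * (y + l₁) + (l - l₁) / (l₂ - l₁) * (y + l₂) = y + l by
      field_simp; ring] at hconv
    rw [show freeVal U K (y + l₁) = optVal U K c y + l₁ * c by linarith,
      show freeVal U K (y + l₂) = optVal U K c y + l₂ * c by linarith] at hconv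
    rw [show (l₂ - l) / (l₂ - l₁) * -(optVal U K c y + l₁ * c) +
      (l - l₁) / (l₂ - l₁) * -(optVal U K c y + l₂ * c) = -(optVal U K c y + l * c) by
      field_simp; ring] at hconv
    linarith
  obtain ⟨q, hq1, hq2⟩ := exists_rat_btwn (add_lt_add_right hlt y)
  refine hcs ⟨q, HasDerivAt.deriv ?_⟩
  have hlin : HasDerivAt (fun z => optVal U K c y + (z - y) * c) c (q : ℝ) := by
    simpa using (((hasDerivAt_id (q : ℝ)).sub_const y).mul_const c).const_add (optVal U K c y)
  refine hlin.congr_of_eventuallyEq ?_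
  filter_upwards [Ioo_mem_nhds hq1 hq2] with z hz
  rw [← hflat (z - y) ⟨by linarith [hz.1], by linarith [hz.2]⟩]
  ring_nf

theorem hasDerivAt_level {c y l : ℝ} (hc : 0 < c)
    (hcs : c ∉ Set.range fun q : ℚ => deriv (freeVal U K) q) (hl : 0 ≤ l)
    (hdual : freeVal U K (y + l) - l * c = optVal U K c y) :
    HasDerivAt (fun c => optVal U K c y) (-l) c := by
  refine (h.convexOn_optVal y).hasDerivAt_of_subgradient_unique (by simpa using hc) fun t ht => ?_
  obtain ⟨h1, h2⟩ := h.of_subgradient hc.le ht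
  have := h.multiplier_unique hc.le hcs h1 hl h2 hdual
  linarith

/-- The value is squeezed between the cost line of the optimal policy and a dual lower bound.
Differentiability of `freeVal` is used only when the multiplier vanishes. -/
theorem hasDerivAt_price {c y l : ℝ} {π : P} (hc : 0 < c)
    (hy : DifferentiableAt ℝ (fun z => -freeVal U K z) y) (hl : 0 ≤ l) (hπ : K π ≤ c)
    (hopt : optVal U K c y = U π + y * K π)
    (hdual : freeVal U K (y + l) - l * c = optVal U K c y) :
    HasDerivAt (fun y => optVal U K c y) (K π) y := by
  have hup : HasDerivAt (fun y => U π + y * K π) (K π) y := by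
    simpa using ((hasDerivAt_id y).mul_const (K π)).const_add (U π)
  have hfu : ∀ y', optVal U K c y' ≤ U π + y' * K π := fun y' => h.optVal_le hπ
  rcases hl.eq_or_lt with rfl | hl
  · simp only [add_zero, zero_mul, sub_zero] at hdual
    have hlf : ∀ y', freeVal U K y' ≤ optVal U K c y' := fun y' => by
      simpa using h.freeVal_sub_le_optVal (y := y') hc.le le_rfl
    have hd : HasDerivAt (freeVal U K) (-deriv (fun z => -freeVal U K z) y) y := by
      simpa using hy.hasDerivAt.fun_neg
    -- `freeVal` touches the upper line from below, so its derivative must be `K π`.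
    have he := hd.eq_of_le hup (fun y' => (hlf y').trans (hfu y')) (hdual.trans hopt)
    rw [he] at hd
    exact hd.of_squeeze hup (.of_forall hlf) (.of_forall hfu) hdual hopt.symm
  · have hk : K π = c := by
      have := (mul_eq_zero.1 (h.complementary hl.le hπ hopt hdual)).resolve_left hl.ne'
      linarith
    -- The total price `y + l` is held fixed: at price `y'` the multiplier is `y + l - y'`, which is
    -- nonnegative near `y` because `l > 0`.
    have hlow : HasDerivAt (fun y' => freeVal U K (y + l) - (y + l - y') * c) (K π) y := by
      rw [hk]
      simpa using (((hasDerivAt_id y).const_sub (y + l)).mul_const c).const_sub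
        (freeVal U K (y + l))
    refine hlow.of_squeeze hup ?_ (.of_forall hfu) ?_ hopt.symm
    · filter_upwards [Iio_mem_nhds (show y < y + l by linarith)] with y' hy'
      have := h.freeVal_sub_le_optVal (y := y') (l := y + l - y') hc.le (sub_nonneg.2 (le_of_lt hy'))
      rwa [add_sub_cancel] at this
    · rw [add_sub_cancel_left]
      exact hdual

end IsConvexProgram

end CrowdCMDP

/-! ### Discounted occupation measures -/

namespace CrowdCMDP

namespace LocalModel

variable {S A : Type*} {m : LocalModel S A}

open ENNReal

/-- The discounted occupation measure of the states. -/
noncomputable def stateOcc (γ : ℝ) (π : m.Policy) (s : S) : ℝ≥0∞ :=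
  ∑' t : ℕ, ENNReal.ofReal γ ^ t * stateLaw π t s

/-- The discounted occupation measure of the pairs of a state and an action. -/
noncomputable def occ (γ : ℝ) (π : m.Policy) (x : S × A) : ℝ≥0∞ :=
  stateOcc γ π x.1 * π.1 x.1 x.2

theorem policy_eq_zero (π : m.Policy) {s : S} {a : A} (ha : a ∉ m.avail s) : π.1 s a = 0 := by
  by_contra h
  exact ha (π.2 s a ((PMF.mem_support_iff _ _).2 h))

theorem pairLaw_apply (π : m.Policy) (t : ℕ) (x : S × A) :
    pairLaw π t x = stateLaw π t x.1 * π.1 x.1 x.2 := by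
  obtain ⟨s, a⟩ := x
  rw [pairLaw, PMF.bind_apply, tsum_eq_single s]
  · rw [PMF.map_apply, tsum_eq_single a]
    · simp
    · intro a' ha
      simp [ha.symm]
  · intro s' hs
    simp [PMF.map_apply, hs.symm]

theorem stateLaw_succ (π : m.Policy) (t : ℕ) (s' : S) :
    stateLaw π (t + 1) s' =
      ∑' s, stateLaw π t s * ∑' a, π.1 s a * m.trans s a s' := by
  simp [stateLaw, PMF.bind_apply]

theorem occ_eq_tsum (γ : ℝ) (π : m.Policy) (x : S × A) :
    occ γ π x = ∑' t : ℕ, ENNReal.ofReal γ ^ t * pairLaw π t x := by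
  simp only [occ, stateOcc, pairLaw_apply, ← ENNReal.tsum_mul_right, mul_assoc]

theorem tsum_stateOcc (γ : ℝ) (π : m.Policy) :
    ∑' s, stateOcc γ π s = (1 - ENNReal.ofReal γ)⁻¹ := by
  simp only [stateOcc]
  rw [ENNReal.tsum_comm]
  simp [ENNReal.tsum_mul_left, PMF.tsum_coe, ENNReal.tsum_geometric]

theorem tsum_occ (γ : ℝ) (π : m.Policy) : ∑' x, occ γ π x = (1 - ENNReal.ofReal γ)⁻¹ := by
  rw [← tsum_stateOcc γ π, ENNReal.tsum_prod']
  simp [occ, ENNReal.tsum_mul_left, PMF.tsum_coe]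

theorem inv_one_sub_ne_top {γ : ℝ} (hγ1 : γ < 1) : (1 - ENNReal.ofReal γ)⁻¹ ≠ ∞ := by
  rw [ENNReal.inv_ne_top, ← pos_iff_ne_zero, tsub_pos_iff_lt]
  simpa using hγ1

theorem occ_ne_top {γ : ℝ} (hγ1 : γ < 1) (π : m.Policy) (x : S × A) : occ γ π x ≠ ∞ :=
  ENNReal.ne_top_of_tsum_ne_top (by rw [tsum_occ]; exact inv_one_sub_ne_top hγ1) x

theorem stateOcc_ne_top {γ : ℝ} (hγ1 : γ < 1) (π : m.Policy) (s : S) : stateOcc γ π s ≠ ∞ :=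
  ENNReal.ne_top_of_tsum_ne_top (by rw [tsum_stateOcc]; exact inv_one_sub_ne_top hγ1) s

variable {γ : ℝ} {f : S → A → ℝ} {C : ℝ}

theorem summable_occ (hγ1 : γ < 1) (π : m.Policy) : Summable fun x => (occ γ π x).toReal :=
  ENNReal.summable_toReal (by rw [tsum_occ]; exact inv_one_sub_ne_top hγ1)

/-- Bounds on `f` are known only at admissible pairs; the others carry no mass. -/
theorem abs_mul_le_of_avail (hf : ∀ s, ∀ a ∈ m.avail s, |f s a| ≤ C) {p : ℝ≥0∞} {x : S × A}
    (hp : x.2 ∉ m.avail x.1 → p = 0) : |p.toReal * f x.1 x.2| ≤ p.toReal * C := by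
  rw [abs_mul, abs_of_nonneg ENNReal.toReal_nonneg]
  by_cases hx : x.2 ∈ m.avail x.1
  · exact mul_le_mul_of_nonneg_left (hf _ _ hx) ENNReal.toReal_nonneg
  · simp [hp hx]

theorem occ_eq_zero (π : m.Policy) {x : S × A} (hx : x.2 ∉ m.avail x.1) : occ γ π x = 0 := by
  rw [occ, policy_eq_zero π hx, mul_zero]

theorem summable_occ_mul (hγ1 : γ < 1) (π : m.Policy)
    (hf : ∀ s, ∀ a ∈ m.avail s, |f s a| ≤ C) :
    Summable fun x => (occ γ π x).toReal * f x.1 x.2 :=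
  Summable.of_norm_bounded ((summable_occ hγ1 π).mul_right C) fun x =>
    abs_mul_le_of_avail (x := x) hf (occ_eq_zero π)

theorem discounted_eq (hγ0 : 0 ≤ γ) (hγ1 : γ < 1) (π : m.Policy)
    (hf : ∀ s, ∀ a ∈ m.avail s, |f s a| ≤ C) :
    discounted γ π f = ∑' x, (occ γ π x).toReal * f x.1 x.2 := by
  have hfin : ∑' p : ℕ × (S × A), ENNReal.ofReal γ ^ p.1 * pairLaw π p.1 p.2 ≠ ∞ := by
    rw [ENNReal.tsum_prod (f := fun t x => ENNReal.ofReal γ ^ t * pairLaw π t x), ENNReal.tsum_comm]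
    simp only [← occ_eq_tsum, tsum_occ]
    exact inv_one_sub_ne_top hγ1
  have hsum : Summable (Function.uncurry fun (t : ℕ) (x : S × A) =>
      (ENNReal.ofReal γ ^ t * pairLaw π t x).toReal * f x.1 x.2) := by
    refine Summable.of_norm_bounded ((ENNReal.summable_toReal hfin).mul_right C) fun p =>
      abs_mul_le_of_avail (x := p.2) hf fun hx => ?_
    rw [pairLaw_apply, policy_eq_zero π hx, mul_zero, mul_zero]
  have hterm : ∀ (t : ℕ) (x : S × A), (ENNReal.ofReal γ ^ t * pairLaw π t x).toReal =
      γ ^ t * (pairLaw π t x).toReal := fun t x => by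
    rw [ENNReal.toReal_mul, ENNReal.toReal_pow, ENNReal.toReal_ofReal hγ0]
  calc discounted γ π f
      = ∑' (t : ℕ) (x : S × A), (ENNReal.ofReal γ ^ t * pairLaw π t x).toReal * f x.1 x.2 := by
        simp only [discounted, ← tsum_mul_left, hterm, mul_assoc]
    _ = ∑' (x : S × A) (t : ℕ), (ENNReal.ofReal γ ^ t * pairLaw π t x).toReal * f x.1 x.2 :=
        hsum.tsum_comm.symm
    _ = _ := by
        refine tsum_congr fun x => ?_
        rw [tsum_mul_right, occ_eq_tsum, ENNReal.tsum_toReal_eq]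
        intro t
        have := occ_ne_top hγ1 π x
        rw [occ_eq_tsum] at this
        exact ENNReal.ne_top_of_tsum_ne_top this t

theorem abs_discounted_le (hγ0 : 0 ≤ γ) (hγ1 : γ < 1) (π : m.Policy)
    (hf : ∀ s, ∀ a ∈ m.avail s, |f s a| ≤ C) :
    |discounted γ π f| ≤ (1 - ENNReal.ofReal γ)⁻¹.toReal * C := by
  rw [discounted_eq hγ0 hγ1 π hf]
  have h1 := (summable_occ hγ1 π).mul_right C
  refine (tsum_of_norm_bounded (f := fun x => (occ γ π x).toReal * f x.1 x.2) h1.hasSum fun x =>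
    abs_mul_le_of_avail (x := x) hf (occ_eq_zero π)).trans (le_of_eq ?_)
  rw [tsum_mul_right, ← ENNReal.tsum_toReal_eq (occ_ne_top hγ1 π), tsum_occ]

theorem discounted_add_mul (hγ0 : 0 ≤ γ) (hγ1 : γ < 1) (π : m.Policy) {f' : S → A → ℝ} {C' : ℝ}
    (hf : ∀ s, ∀ a ∈ m.avail s, |f s a| ≤ C) (hf' : ∀ s, ∀ a ∈ m.avail s, |f' s a| ≤ C') (y : ℝ) :
    discounted γ π (fun s a => f s a + f' s a * y) = discounted γ π f + y * discounted γ π f' := by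
  have hb : ∀ s, ∀ a ∈ m.avail s, |f s a + f' s a * y| ≤ C + C' * |y| := fun s a ha => by
    refine (abs_add_le _ _).trans (add_le_add (hf s a ha) ?_)
    rw [abs_mul]
    exact mul_le_mul_of_nonneg_right (hf' s a ha) (abs_nonneg y)
  rw [discounted_eq hγ0 hγ1 π hb, discounted_eq hγ0 hγ1 π hf, discounted_eq hγ0 hγ1 π hf',
    ← tsum_mul_left, ← (summable_occ_mul hγ1 π hf).tsum_add
    ((summable_occ_mul hγ1 π hf').mul_left y)]
  exact tsum_congr fun x => by ring

/-! ### Mixtures of occupation measures -/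

/-- The discounted flow equation. -/
theorem stateOcc_flow (π : m.Policy) (s' : S) :
    stateOcc γ π s' = m.init s' +
      ENNReal.ofReal γ * ∑' s, stateOcc γ π s * ∑' a, π.1 s a * m.trans s a s' := by
  rw [stateOcc, tsum_eq_zero_add' ENNReal.summable]
  congr 1
  · simp [stateLaw]
  · simp only [stateLaw_succ, stateOcc, pow_succ', mul_assoc, ENNReal.tsum_mul_left]
    congr 1
    simp only [← ENNReal.tsum_mul_right (f := fun t : ℕ => ENNReal.ofReal γ ^ t * stateLaw π t _)]
    rw [ENNReal.tsum_comm]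
    simp only [← ENNReal.tsum_mul_left, mul_assoc]

/-- The occupation measure is the least solution of the flow equation. -/
theorem stateOcc_le_of_flow (π : m.Policy) {μ : S → ℝ≥0∞}
    (hμ : ∀ s', μ s' = m.init s' +
      ENNReal.ofReal γ * ∑' s, μ s * ∑' a, π.1 s a * m.trans s a s') (s : S) :
    stateOcc γ π s ≤ μ s := by
  -- The partial sums are the iterates of the flow map started at zero, and this map is monotone
  -- with fixed point `μ`.
  have key : ∀ n s', ∑ t ∈ Finset.range n, ENNReal.ofReal γ ^ t * stateLaw π t s' ≤ μ s' := by
    intro n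
    induction n with
    | zero => simp
    | succ n ih =>
      intro s'
      rw [Finset.sum_range_succ', hμ s', add_comm]
      refine add_le_add (by simp [stateLaw]) ?_
      simp only [stateLaw_succ, pow_succ', mul_assoc, ← Finset.mul_sum]
      gcongr
      simp only [← ENNReal.tsum_mul_left]
      rw [← Summable.tsum_finsetSum fun _ _ => ENNReal.summable]
      refine ENNReal.tsum_le_tsum fun s => ?_
      calc _ = (∑ t ∈ Finset.range n, ENNReal.ofReal γ ^ t * stateLaw π t s) *
            ∑' a, π.1 s a * m.trans s a s' := by
            rw [Finset.sum_mul]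
            exact Finset.sum_congr rfl fun t _ => by simp only [ENNReal.tsum_mul_left, mul_assoc]
        _ ≤ _ := by
            rw [ENNReal.tsum_mul_left]
            exact mul_le_mul_left (ih s) _
  exact ENNReal.tsum_le_of_sum_range_le fun n => key n s

/-- A least solution with the same finite total mass cannot be strictly smaller anywhere. -/
theorem stateOcc_eq_of_flow (hγ1 : γ < 1) (π : m.Policy) {μ : S → ℝ≥0∞}
    (hμ : ∀ s', μ s' = m.init s' +
      ENNReal.ofReal γ * ∑' s, μ s * ∑' a, π.1 s a * m.trans s a s')
    (hmass : ∑' s, μ s = (1 - ENNReal.ofReal γ)⁻¹) (s : S) : stateOcc γ π s = μ s := by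
  refine (stateOcc_le_of_flow π hμ s).eq_of_not_lt fun hlt => ?_
  have := ENNReal.tsum_lt_tsum (by rw [tsum_stateOcc]; exact inv_one_sub_ne_top hγ1)
    (stateOcc_le_of_flow π hμ) hlt
  rw [tsum_stateOcc, hmass] at this
  exact this.false

/-- The policy is the conditional law of the action given the state under the mixture `ρ`. The mixed
state marginal `μ` then solves the flow equation of this policy and has the right mass. -/
theorem exists_policy_occ_eq (hγ1 : γ < 1) (π₁ π₂ : m.Policy) {w v : ℝ≥0∞} (hwv : w + v = 1) :
    ∃ π : m.Policy, ∀ x, occ γ π x = w * occ γ π₁ x + v * occ γ π₂ x := by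
  classical
  have hw : w ≠ ∞ := ne_top_of_le_ne_top one_ne_top (hwv ▸ le_self_add)
  have hv : v ≠ ∞ := ne_top_of_le_ne_top one_ne_top (hwv ▸ le_add_self)
  set ρ : S → A → ℝ≥0∞ := fun s a => w * occ γ π₁ (s, a) + v * occ γ π₂ (s, a) with hρ
  set μ : S → ℝ≥0∞ := fun s => w * stateOcc γ π₁ s + v * stateOcc γ π₂ s with hμ
  have hρμ : ∀ s, ∑' a, ρ s a = μ s := fun s => by
    simp [hρ, hμ, occ, ENNReal.tsum_add, ENNReal.tsum_mul_left, PMF.tsum_coe]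
  have hμt : ∀ s, μ s ≠ ∞ := fun s => ENNReal.add_ne_top.2
    ⟨ENNReal.mul_ne_top hw (stateOcc_ne_top hγ1 π₁ s),
      ENNReal.mul_ne_top hv (stateOcc_ne_top hγ1 π₂ s)⟩
  -- In states of mass zero any admissible choice would do.
  let p : S → PMF A := fun s => if h : μ s = 0 then π₁.1 s else
    PMF.normalize (ρ s) (by rwa [hρμ]) (by rw [hρμ]; exact hμt s)
  have hp : ∀ s a, μ s * p s a = ρ s a := by
    intro s a
    by_cases h : μ s = 0
    · have : ρ s a = 0 := ENNReal.tsum_eq_zero.1 ((hρμ s).trans h) a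
      rw [h, this, zero_mul]
    · simp only [p, h, dite_false, PMF.normalize_apply, hρμ]
      rw [mul_left_comm, ENNReal.mul_inv_cancel h (hμt s), mul_one]
  have hadm : ∀ s, ∀ a ∈ (p s).support, a ∈ m.avail s := by
    intro s a ha
    by_cases h : μ s = 0
    · simp only [p, h, dite_true] at ha
      exact π₁.2 s a ha
    · by_contra hna
      rw [PMF.mem_support_iff] at ha
      have h0 : ρ s a = 0 := by
        simp [hρ, occ_eq_zero π₁ (x := (s, a)) hna, occ_eq_zero π₂ (x := (s, a)) hna]
      rw [← hp] at h0
      exact (mul_ne_zero h ha) h0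
  obtain ⟨π, hπ⟩ : ∃ π : m.Policy, π.1 = p := ⟨⟨p, hadm⟩, rfl⟩
  simp only [← hπ] at hp
  refine ⟨π, fun x => ?_⟩
  rw [show occ γ π x = stateOcc γ π x.1 * π.1 x.1 x.2 from rfl,
    stateOcc_eq_of_flow hγ1 π (μ := μ)]
  · exact hp x.1 x.2
  · intro s'
    have e : ∀ s, μ s * ∑' a, π.1 s a * m.trans s a s' =
        w * (stateOcc γ π₁ s * ∑' a, π₁.1 s a * m.trans s a s') +
        v * (stateOcc γ π₂ s * ∑' a, π₂.1 s a * m.trans s a s') := by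
      intro s
      simp only [← ENNReal.tsum_mul_left, ← ENNReal.tsum_add, ← mul_assoc, hp]
      refine tsum_congr fun a => ?_
      simp only [hρ, occ]
      ring
    simp only [e, ENNReal.tsum_add, ENNReal.tsum_mul_left]
    simp only [hμ]
    conv_lhs => rw [stateOcc_flow π₁ s', stateOcc_flow π₂ s']
    have hi : m.init s' = w * m.init s' + v * m.init s' := by rw [← add_mul, hwv, one_mul]
    conv_rhs => rw [hi]
    ring
  · simp only [hμ, ENNReal.tsum_add, ENNReal.tsum_mul_left, tsum_stateOcc]
    rw [← add_mul, hwv, one_mul]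

/-- One policy serves all `f`, so utility and cost are mixed simultaneously. -/
theorem exists_policy_discounted_eq (hγ0 : 0 ≤ γ) (hγ1 : γ < 1) (π₁ π₂ : m.Policy) {w : ℝ}
    (hw0 : 0 ≤ w) (hw1 : w ≤ 1) : ∃ π : m.Policy, ∀ (f : S → A → ℝ) (C : ℝ),
      (∀ s, ∀ a ∈ m.avail s, |f s a| ≤ C) →
      discounted γ π f = w * discounted γ π₁ f + (1 - w) * discounted γ π₂ f := by
  have hw1' : 0 ≤ 1 - w := sub_nonneg.2 hw1
  obtain ⟨π, hπ⟩ := exists_policy_occ_eq hγ1 π₁ π₂ (w := ENNReal.ofReal w)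
    (v := ENNReal.ofReal (1 - w)) (by rw [← ENNReal.ofReal_add hw0 hw1']; simp)
  refine ⟨π, fun f C hf => ?_⟩
  rw [discounted_eq hγ0 hγ1 π hf, discounted_eq hγ0 hγ1 π₁ hf, discounted_eq hγ0 hγ1 π₂ hf,
    ← tsum_mul_left, ← tsum_mul_left, ← ((summable_occ_mul hγ1 π₁ hf).mul_left w).tsum_add
    ((summable_occ_mul hγ1 π₂ hf).mul_left (1 - w))]
  refine tsum_congr fun x => ?_
  rw [hπ, ENNReal.toReal_add (ENNReal.mul_ne_top ofReal_ne_top (occ_ne_top hγ1 π₁ x))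
    (ENNReal.mul_ne_top ofReal_ne_top (occ_ne_top hγ1 π₂ x)), ENNReal.toReal_mul,
    ENNReal.toReal_mul, ENNReal.toReal_ofReal hw0, ENNReal.toReal_ofReal hw1']
  ring

end LocalModel

end CrowdCMDP

/-! ### Existence of constrained minimizers by compactness -/

namespace CrowdCMDP

namespace LocalModel

variable {S A : Type*} {m : LocalModel S A}

open ENNReal

theorem _root_.LowerSemicontinuous.ennreal_mul {X : Type*} [TopologicalSpace X] {f g : X → ℝ≥0∞}
    (hf : LowerSemicontinuous f) (hg : LowerSemicontinuous g) :
    LowerSemicontinuous fun x => f x * g x := by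
  intro x
  refine lowerSemicontinuousAt_iff_le_liminf.2 ?_
  exact (mul_le_mul' (lowerSemicontinuousAt_iff_le_liminf.1 (hf x))
    (lowerSemicontinuousAt_iff_le_liminf.1 (hg x))).trans ENNReal.le_liminf_mul

/-- The law of the state at time `t` under a kernel that need not be stochastic. -/
noncomputable def kernelLaw (m : LocalModel S A) (q : S → A → ℝ≥0∞) : ℕ → S → ℝ≥0∞
  | 0 => fun s => m.init s
  | t + 1 => fun s' => ∑' s, kernelLaw m q t s * ∑' a, q s a * m.trans s a s'

theorem kernelLaw_eq (π : m.Policy) (t : ℕ) :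
    kernelLaw m (fun s a => π.1 s a) t = fun s => stateLaw π t s := by
  induction t with
  | zero => rfl
  | succ t ih =>
    funext s'
    rw [stateLaw_succ, kernelLaw, ih]

theorem lowerSemicontinuous_apply (s : S) (a : A) :
    LowerSemicontinuous fun q : S → A → ℝ≥0∞ => q s a :=
  (continuous_apply_apply s a).lowerSemicontinuous

/-- Only lower semicontinuity is claimed: an infinite sum of nonnegative terms may lose mass in a
pointwise limit. -/
theorem lowerSemicontinuous_kernelLaw (t : ℕ) (s : S) :
    LowerSemicontinuous fun q => kernelLaw m q t s := by
  induction t generalizing s with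
  | zero => exact lowerSemicontinuous_const
  | succ t ih =>
    exact lowerSemicontinuous_tsum fun s' => (ih s').ennreal_mul <|
      lowerSemicontinuous_tsum fun a =>
        (lowerSemicontinuous_apply s' a).ennreal_mul lowerSemicontinuous_const

/-- The discounted sum of a nonnegative function under a kernel. -/
noncomputable def kernelSum (m : LocalModel S A) (γ : ℝ) (F : S × A → ℝ≥0∞)
    (q : S → A → ℝ≥0∞) : ℝ≥0∞ :=
  ∑' x : S × A, (∑' t : ℕ, ENNReal.ofReal γ ^ t * kernelLaw m q t x.1) * q x.1 x.2 * F x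

theorem lowerSemicontinuous_kernelSum (γ : ℝ) (F : S × A → ℝ≥0∞) :
    LowerSemicontinuous (kernelSum m γ F) :=
  lowerSemicontinuous_tsum fun x => LowerSemicontinuous.ennreal_mul
    (LowerSemicontinuous.ennreal_mul
      (lowerSemicontinuous_tsum fun t =>
        lowerSemicontinuous_const.ennreal_mul (lowerSemicontinuous_kernelLaw t x.1))
      (lowerSemicontinuous_apply x.1 x.2))
    lowerSemicontinuous_const

theorem kernelSum_eq (γ : ℝ) (F : S × A → ℝ≥0∞) (π : m.Policy) :
    kernelSum m γ F (fun s a => π.1 s a) = ∑' x, occ γ π x * F x := by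
  simp only [kernelSum, kernelLaw_eq, occ, stateOcc]

/-- The stochastic kernels that use only admissible actions. -/
def kernels (m : LocalModel S A) : Set (S → A → ℝ≥0∞) :=
  {q | ∀ s, (∀ a, a ∉ m.avail s → q s a = 0) ∧ ∑ a ∈ m.avail s, q s a = 1}

/-- The ambient product of copies of `ℝ≥0∞` is compact. Total mass one is a closed condition because
each `avail s` is finite. -/
theorem isCompact_kernels : IsCompact m.kernels := by
  refine IsClosed.isCompact ?_
  simp only [kernels, Set.ofPred_forall, Set.ofPred_and]
  refine isClosed_iInter fun s => IsClosed.inter ?_ ?_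
  · refine isClosed_iInter fun a => isClosed_iInter fun _ => ?_
    exact isClosed_eq (continuous_apply_apply s a) continuous_const
  · exact isClosed_eq (continuous_finsetSum _ fun a _ => continuous_apply_apply s a)
      continuous_const

theorem mem_kernels (π : m.Policy) : (fun s a => π.1 s a) ∈ m.kernels := by
  refine fun s => ⟨fun a ha => policy_eq_zero π ha, ?_⟩
  rw [← (π.1 s).tsum_coe]
  exact (tsum_eq_sum fun a ha => policy_eq_zero π ha).symm

theorem exists_policy_of_mem_kernels {q : S → A → ℝ≥0∞} (hq : q ∈ m.kernels) :
    ∃ π : m.Policy, (fun s a => π.1 s a) = q :=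
  ⟨⟨fun s => PMF.ofFinset (q s) (m.avail s) (hq s).2 (hq s).1, fun s a ha => by
    by_contra hna
    exact (PMF.mem_support_iff _ _).1 ha ((hq s).1 a hna)⟩, rfl⟩

variable {γ : ℝ} {f : S → A → ℝ} {C : ℝ}

theorem ofReal_discounted (hγ0 : 0 ≤ γ) (hγ1 : γ < 1) (π : m.Policy)
    (hf : ∀ s, ∀ a ∈ m.avail s, |f s a| ≤ C) (hf0 : ∀ s, ∀ a ∈ m.avail s, 0 ≤ f s a) :
    ENNReal.ofReal (discounted γ π f) =
      kernelSum m γ (fun x => ENNReal.ofReal (f x.1 x.2)) (fun s a => π.1 s a) := by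
  rw [kernelSum_eq, discounted_eq hγ0 hγ1 π hf,
    ENNReal.ofReal_tsum_of_nonneg _ (summable_occ_mul hγ1 π hf)]
  · refine tsum_congr fun x => ?_
    rw [ENNReal.ofReal_mul ENNReal.toReal_nonneg, ENNReal.ofReal_toReal (occ_ne_top hγ1 π x)]
  · intro x
    by_cases hx : x.2 ∈ m.avail x.1
    · exact mul_nonneg ENNReal.toReal_nonneg (hf0 _ _ hx)
    · simp [occ_eq_zero π hx]

theorem discounted_nonneg (hγ0 : 0 ≤ γ) (π : m.Policy) (hf0 : ∀ s a, 0 ≤ f s a) :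
    0 ≤ discounted γ π f :=
  tsum_nonneg fun t => mul_nonneg (pow_nonneg hγ0 t) <|
    tsum_nonneg fun _ => mul_nonneg ENNReal.toReal_nonneg (hf0 _ _)

theorem cost_nonneg (s : S) (a : A) : 0 ≤ m.cost s a := by
  rw [cost]; split_ifs <;> norm_num

theorem abs_cost_le (s : S) (a : A) : |m.cost s a| ≤ 1 := by
  rw [cost]; split_ifs <;> norm_num

theorem K_nonneg (hγ0 : 0 ≤ γ) (π : m.Policy) : 0 ≤ K γ π :=
  discounted_nonneg hγ0 π cost_nonneg

theorem exists_policy_K_eq_zero : ∃ π : m.Policy, K γ π = 0 := by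
  choose b hb hbc using m.exists_other
  have hadm : ∀ s, ∀ a ∈ (PMF.pure (b s)).support, a ∈ m.avail s := fun s a ha => by
    rw [PMF.mem_support_pure_iff] at ha
    exact ha ▸ hb s
  obtain ⟨π, hπ⟩ : ∃ π : m.Policy, π.1 = fun s => PMF.pure (b s) := ⟨⟨_, hadm⟩, rfl⟩
  have hzero : ∀ t (x : S × A), (pairLaw π t x).toReal * m.cost x.1 x.2 = 0 := fun t x => by
    rw [pairLaw_apply, hπ]
    by_cases hx : x.2 = m.crowd
    · have : x.2 ≠ b x.1 := fun h => hbc x.1 (h.symm.trans hx)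
      simp [PMF.pure_apply, this]
    · simp [cost, hx]
  exact ⟨π, by simp [K, discounted, hzero]⟩

/-- A constrained minimizer exists for every bounded objective. -/
theorem exists_isMinOn_discounted (hγ0 : 0 ≤ γ) (hγ1 : γ < 1)
    (hf : ∀ s, ∀ a ∈ m.avail s, |f s a| ≤ C) {c : ℝ} (hc : 0 ≤ c) :
    ∃ π : m.Policy, K γ π ≤ c ∧
      ∀ π' : m.Policy, K γ π' ≤ c → discounted γ π f ≤ discounted γ π' f := by
  -- Adding `C` makes the objective nonnegative, as `kernelSum` requires. The discounted mass is the
  -- same for all policies, so minimizers do not change; the factor `1` fits `discounted_add_mul`.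
  have hshift0 : ∀ s, ∀ a ∈ m.avail s, 0 ≤ f s a + 1 * C := fun s a ha => by
    linarith [(abs_le.1 (hf s a ha)).1]
  have hshift : ∀ s, ∀ a ∈ m.avail s, |f s a + 1 * C| ≤ 2 * C := fun s a ha => by
    rw [abs_of_nonneg (hshift0 s a ha)]
    linarith [(abs_le.1 (hf s a ha)).2]
  have hK : ∀ π : m.Policy, K γ π ≤ c ↔
      kernelSum m γ (fun x => ENNReal.ofReal (m.cost x.1 x.2)) (fun s a => π.1 s a) ≤
        ENNReal.ofReal c := fun π => by
    rw [← ofReal_discounted (f := m.cost) hγ0 hγ1 π (fun s a _ => abs_cost_le s a)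
      (fun s a _ => cost_nonneg s a), ENNReal.ofReal_le_ofReal_iff hc, K]
  have hF : ∀ π : m.Policy,
      ENNReal.ofReal (discounted γ π f + C * discounted γ π fun _ _ => (1 : ℝ)) =
      kernelSum m γ (fun x => ENNReal.ofReal (f x.1 x.2 + 1 * C)) (fun s a => π.1 s a) := fun π => by
    rw [← discounted_add_mul (C' := 1) hγ0 hγ1 π hf (by simp) C]
    exact ofReal_discounted (f := fun s a => f s a + 1 * C) hγ0 hγ1 π hshift hshift0
  have hone : ∀ π : m.Policy,
      discounted γ π (fun _ _ => (1 : ℝ)) = (1 - ENNReal.ofReal γ)⁻¹.toReal := fun π => by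
    rw [discounted_eq (C := 1) hγ0 hγ1 π (by simp)]
    simp only [mul_one]
    rw [← ENNReal.tsum_toReal_eq (occ_ne_top hγ1 π), tsum_occ]
  have hcl := (lowerSemicontinuous_kernelSum (m := m) γ
    fun x => ENNReal.ofReal (m.cost x.1 x.2)).isClosed_preimage (ENNReal.ofReal c)
  obtain ⟨π₀, hπ₀⟩ := exists_policy_K_eq_zero (m := m) (γ := γ)
  obtain ⟨q, ⟨hq, hqc⟩, hmin⟩ := LowerSemicontinuousOn.exists_isMinOn
    (f := kernelSum m γ fun x => ENNReal.ofReal (f x.1 x.2 + 1 * C))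
    (s := m.kernels ∩ kernelSum m γ (fun x => ENNReal.ofReal (m.cost x.1 x.2)) ⁻¹'
      Set.Iic (ENNReal.ofReal c))
    ⟨_, mem_kernels π₀, (hK π₀).1 (hπ₀.trans_le hc)⟩ (isCompact_kernels.inter_right hcl)
    ((lowerSemicontinuous_kernelSum γ _).lowerSemicontinuousOn _)
  obtain ⟨π, rfl⟩ := exists_policy_of_mem_kernels hq
  refine ⟨π, (hK π).2 hqc, fun π' hπ' => ?_⟩
  have hle := isMinOn_iff.1 hmin _ ⟨mem_kernels π', (hK π').1 hπ'⟩
  rw [← hF, ← hF, ENNReal.ofReal_le_ofReal_iff, hone, hone] at hle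
  · linarith
  · rw [← discounted_add_mul (C' := 1) hγ0 hγ1 π' hf (by simp) C,
      discounted_eq hγ0 hγ1 π' hshift]
    refine tsum_nonneg fun x => ?_
    by_cases hx : x.2 ∈ m.avail x.1
    · exact mul_nonneg ENNReal.toReal_nonneg (hshift0 _ _ hx)
    · simp [occ_eq_zero π' hx]

theorem discounted_reward (hγ0 : 0 ≤ γ) (hγ1 : γ < 1) (π : m.Policy) (y : ℝ) :
    discounted γ π (fun s a => m.utility s a + m.cost s a * y) =
      discounted γ π m.utility + y * K γ π := by
  obtain ⟨C, hC⟩ := m.utility_bdd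
  exact discounted_add_mul hγ0 hγ1 π hC (fun s a _ => abs_cost_le s a) y

theorem J_eq (hγ0 : 0 ≤ γ) (hγ1 : γ < 1) (d : ℝ → ℝ) (x : ℝ) (π : m.Policy) :
    J γ d x π = discounted γ π m.utility + d (1 + x) * K γ π :=
  discounted_reward hγ0 hγ1 π (d (1 + x))

theorem isConvexProgram (m : LocalModel S A) (hγ0 : 0 ≤ γ) (hγ1 : γ < 1) :
    IsConvexProgram (fun π : m.Policy => discounted γ π m.utility) (fun π => K γ π) where
  bdd := by
    obtain ⟨C, hC⟩ := m.utility_bdd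
    refine ⟨max ((1 - ENNReal.ofReal γ)⁻¹.toReal * C) ((1 - ENNReal.ofReal γ)⁻¹.toReal * 1),
      fun π => ⟨(abs_discounted_le hγ0 hγ1 π hC).trans (le_max_left _ _), ?_⟩⟩
    exact (le_abs_self _).trans ((abs_discounted_le hγ0 hγ1 π
      (fun s a _ => abs_cost_le s a)).trans (le_max_right _ _))
  nonneg := K_nonneg hγ0
  exists_zero := exists_policy_K_eq_zero
  mix π₁ π₂ w hw0 hw1 := by
    obtain ⟨C, hC⟩ := m.utility_bdd
    obtain ⟨π, hπ⟩ := exists_policy_discounted_eq hγ0 hγ1 π₁ π₂ hw0 hw1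
    exact ⟨π, hπ _ C hC, hπ _ 1 fun s a _ => abs_cost_le s a⟩
  attained c hc y := by
    obtain ⟨C, hC⟩ := m.utility_bdd
    have hb : ∀ s, ∀ a ∈ m.avail s, |m.utility s a + m.cost s a * y| ≤ C + 1 * |y| :=
      fun s a ha => by
        refine (abs_add_le _ _).trans (add_le_add (hC s a ha) ?_)
        rw [abs_mul]
        exact mul_le_mul_of_nonneg_right (abs_cost_le s a) (abs_nonneg y)
    obtain ⟨π, h1, h2⟩ := exists_isMinOn_discounted hγ0 hγ1 hb hc
    refine ⟨π, h1, fun π' hπ' => ?_⟩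
    have := h2 π' hπ'
    rwa [discounted_reward hγ0 hγ1, discounted_reward hγ0 hγ1] at this

end LocalModel

end CrowdCMDP

/-! ### Null sets of parameters -/

-- Each fibre of a nonzero functional is empty or a proper affine subspace, hence null.
open MeasureTheory in
theorem LinearMap.ae_notMem_of_countable {E : Type*} [NormedAddCommGroup E] [NormedSpace ℝ E]
    [MeasurableSpace E] [BorelSpace E] [FiniteDimensional ℝ E] (μ : Measure E) [μ.IsAddHaarMeasure]
    (L : E →ₗ[ℝ] ℝ) (hL : L ≠ 0) {D : Set ℝ} (hD : D.Countable) : ∀ᵐ θ ∂μ, L θ ∉ D := by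
  have hpt : ∀ x, μ {θ | L θ = x} = 0 := by
    intro x
    by_cases hx : ∃ θ₀, L θ₀ = x
    · obtain ⟨θ₀, rfl⟩ := hx
      refine measure_mono_null (fun θ (hθ : L θ = L θ₀) => ?_)
        (Measure.addHaar_affineSubspace μ (AffineSubspace.mk' θ₀ (LinearMap.ker L)) fun h => hL ?_)
      · simp [AffineSubspace.mem_mk', hθ]
      · rw [← LinearMap.ker_eq_top, ← AffineSubspace.direction_mk' θ₀ (LinearMap.ker L), h,
          AffineSubspace.direction_top]
    · rw [show {θ | L θ = x} = ∅ from Set.eq_empty_of_forall_notMem fun θ hθ => hx ⟨θ, hθ⟩,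
        measure_empty]
  have hall : ∀ᵐ θ ∂μ, ∀ x ∈ D, L θ ≠ x := (ae_ball_iff hD).2 fun x _ => by
    simpa [ae_iff] using hpt x
  filter_upwards [hall] with θ hθ hmem
  exact hθ _ hmem rfl

/-! ### Translation to the agents and conclusion -/

namespace CrowdCMDP

section Agents

variable {N : ℕ} {S A : Fin N → Type*} (m : ∀ i, LocalModel (S i) (A i))
  {γ : ℝ} (d : ℝ → ℝ) {M : ℝ}

theorem value_eq_optVal (hγ0 : 0 ≤ γ) (hγ1 : γ < 1) (i : Fin N) (θ : Fin N → ℝ) :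
    value m γ d i θ =
      optVal (fun π : (m i).Policy => LocalModel.discounted γ π (m i).utility)
        (fun π => LocalModel.K γ π) (θ i) (d (1 + others i θ)) := by
  simp only [value, optVal, LocalModel.J_eq hγ0 hγ1]

/-- The normalized multiplier acts as a surcharge `l / M` on the price. -/
theorem dual_eq_freeVal (hγ0 : 0 ≤ γ) (hγ1 : γ < 1) (i : Fin N) (θ : Fin N → ℝ) (l : ℝ) :
    dual m γ d M i θ l =
      freeVal (fun π : (m i).Policy => LocalModel.discounted γ π (m i).utility)
        (fun π => LocalModel.K γ π) (d (1 + others i θ) + l / M) - l / M * θ i := by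
  have h := (m i).isConvexProgram hγ0 hγ1
  have := h.nonempty
  rw [dual, freeVal, sub_eq_add_neg, ciInf_add (h.bddBelow _)]
  refine iInf_congr fun π => ?_
  rw [lagrangian, LocalModel.J_eq hγ0 hγ1]
  ring

theorem isOptimalPolicy_iff (hγ0 : 0 ≤ γ) (hγ1 : γ < 1) (i : Fin N) (θ : Fin N → ℝ)
    (π : (m i).Policy) :
    IsOptimalPolicy m γ d i θ π ↔ LocalModel.K γ π ≤ θ i ∧
      value m γ d i θ = LocalModel.discounted γ π (m i).utility +
        d (1 + others i θ) * LocalModel.K γ π := by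
  have h := (m i).isConvexProgram hγ0 hγ1
  simp only [IsOptimalPolicy, LocalModel.J_eq hγ0 hγ1, value_eq_optVal m d hγ0 hγ1]
  refine and_congr_right fun hπ => ⟨fun hmin => IsConvexProgram.optVal_eq hπ hmin, fun he π' hπ' => ?_⟩
  rw [← he]
  exact h.optVal_le hπ'

/-- By strong duality the dual maximum is the primal value, so the maximizers are exactly the
multipliers that close the gap. -/
theorem isOptimalMultiplier_iff (hγ0 : 0 ≤ γ) (hγ1 : γ < 1) (hM : 0 < M) (i : Fin N)
    (θ : Fin N → ℝ) (hθ : 0 < θ i) (l : ℝ) :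
    IsOptimalMultiplier m γ d M i θ l ↔ 0 ≤ l ∧ dual m γ d M i θ l = value m γ d i θ := by
  have h := (m i).isConvexProgram hγ0 hγ1
  have hweak : ∀ l', 0 ≤ l' → dual m γ d M i θ l' ≤ value m γ d i θ := fun l' hl' => by
    rw [dual_eq_freeVal m d hγ0 hγ1, value_eq_optVal m d hγ0 hγ1]
    exact h.freeVal_sub_le_optVal hθ.le (div_nonneg hl' hM.le)
  refine and_congr_right fun hl => ⟨fun hmax => le_antisymm (hweak l hl) ?_,
    fun he l' hl' => (hweak l' hl').trans he.ge⟩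
  obtain ⟨l₀, hl₀, he⟩ := h.exists_multiplier hθ (d (1 + others i θ))
  have := hmax (M * l₀) (mul_nonneg hM.le hl₀)
  rwa [dual_eq_freeVal m d hγ0 hγ1, mul_div_cancel_left₀ _ hM.ne', he,
    ← value_eq_optVal m d hγ0 hγ1] at this

theorem exists_isOptimalMultiplier (hγ0 : 0 ≤ γ) (hγ1 : γ < 1) (hM : 0 < M) (i : Fin N)
    (θ : Fin N → ℝ) (hθ : 0 < θ i) : ∃ l, IsOptimalMultiplier m γ d M i θ l := by
  obtain ⟨l, hl, he⟩ := ((m i).isConvexProgram hγ0 hγ1).exists_multiplier hθ (d (1 + others i θ))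
  refine ⟨M * l, (isOptimalMultiplier_iff m d hγ0 hγ1 hM i θ hθ _).2 ⟨mul_nonneg hM.le hl, ?_⟩⟩
  rw [dual_eq_freeVal m d hγ0 hγ1, mul_div_cancel_left₀ _ hM.ne', he,
    value_eq_optVal m d hγ0 hγ1]

theorem others_update_self (i : Fin N) (θ : Fin N → ℝ) (t : ℝ) :
    others i (Function.update θ i t) = others i θ :=
  Finset.sum_congr rfl fun _ hk => Function.update_of_ne (Finset.ne_of_mem_erase hk) _ _

theorem others_update_of_ne {i j : Fin N} (hij : j ≠ i) (θ : Fin N → ℝ) (t : ℝ) :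
    others i (Function.update θ j t) = others i θ + (t - θ j) := by
  have hj : j ∈ Finset.univ.erase i := Finset.mem_erase.2 ⟨hij, Finset.mem_univ j⟩
  rw [others, others, Finset.sum_update_of_mem hj, ← Finset.add_sum_erase _ θ hj,
    Finset.sdiff_singleton_eq_erase]
  ring

theorem others_pos {i j : Fin N} (hij : j ≠ i) {θ : Fin N → ℝ} (hθ : ∀ k, 0 < θ k) :
    0 < others i θ :=
  Finset.sum_pos (fun k _ => hθ k) ⟨j, Finset.mem_erase.2 ⟨hij, Finset.mem_univ j⟩⟩

/-- The sum over the other agents as a linear functional. -/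
def othersLinear (i : Fin N) : (Fin N → ℝ) →ₗ[ℝ] ℝ :=
  ∑ k ∈ Finset.univ.erase i, LinearMap.proj k

theorem othersLinear_apply (i : Fin N) (θ : Fin N → ℝ) : othersLinear i θ = others i θ := by
  simp [othersLinear, others]

/-- An increasing differentiable penalty composed with the sum over the other agents avoids a
countable set almost everywhere. -/
theorem ae_penalty_notMem {d : ℝ → ℝ} (hd : StrictMonoOn d (Set.Ici 1)) {D : Set ℝ}
    (hD : D.Countable) {i j : Fin N} (hij : j ≠ i) :
    ∀ᵐ θ : Fin N → ℝ ∂MeasureTheory.volume, (∀ k, 0 < θ k) → d (1 + others i θ) ∉ D := by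
  have hc : {x : ℝ | 0 < x ∧ d (1 + x) ∈ D}.Countable := by
    refine Set.MapsTo.countable_of_injOn (f := fun x => d (1 + x)) (t := D) (fun x hx => hx.2) ?_ hD
    intro x hx y hy hxy
    have hx1 : (1 : ℝ) ≤ 1 + x := le_add_of_nonneg_right hx.1.le
    have hy1 : (1 : ℝ) ≤ 1 + y := le_add_of_nonneg_right hy.1.le
    exact add_left_cancel (hd.injOn hx1 hy1 hxy)
  -- The agent `j ≠ i` makes the sum nonempty, so the functional is positive at the all-ones vector.
  have hne : othersLinear i ≠ 0 := fun h => by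
    have h1 := others_pos hij (θ := fun _ => 1) (fun _ => one_pos)
    rw [← othersLinear_apply, h] at h1
    exact h1.false
  filter_upwards [(othersLinear i).ae_notMem_of_countable _ hne hc] with θ hθ hpos hmem
  exact hθ (by rw [othersLinear_apply]; exact ⟨others_pos hij hpos, hmem⟩)

end Agents

end CrowdCMDP

theorem mainTheorem3 {N : ℕ} {S A : Fin N → Type*} [∀ i, Countable (S i)]
    (m : ∀ i, CrowdCMDP.LocalModel (S i) (A i))
    (γ : ℝ) (hγ0 : 0 ≤ γ) (hγ1 : γ < 1)
    (d : ℝ → ℝ) (hd : DifferentiableOn ℝ d (Set.Ici 1))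
    (hd' : ∀ x, 1 ≤ x → 0 < derivWithin d (Set.Ici 1) x)
    (M : ℝ) (hM : 0 < M) :
    ∀ᵐ θ : Fin N → ℝ ∂MeasureTheory.volume, (∀ k, θ k ∈ Set.Ioo 0 M) → ∀ i : Fin N,
      (∃ π, CrowdCMDP.IsOptimalPolicy m γ d i θ π) ∧
      (∃ l, CrowdCMDP.IsOptimalMultiplier m γ d M i θ l) ∧
      ∀ π l, CrowdCMDP.IsOptimalPolicy m γ d i θ π →
        CrowdCMDP.IsOptimalMultiplier m γ d M i θ l →
        CrowdCMDP.value m γ d i θ = CrowdCMDP.lagrangian m γ d M i θ π l ∧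
        HasDerivAt (fun t => CrowdCMDP.value m γ d i (Function.update θ i t)) (-l / M) (θ i) ∧
        -l / M ≤ 0 ∧
        ∀ j, j ≠ i →
          HasDerivAt (fun t => CrowdCMDP.value m γ d i (Function.update θ j t))
            (CrowdCMDP.LocalModel.K γ π * CrowdCMDP.partialPenalty d i j θ) (θ j) ∧
          0 ≤ CrowdCMDP.LocalModel.K γ π * CrowdCMDP.partialPenalty d i j θ ∧
          (CrowdCMDP.LocalModel.K γ π = θ i ∨ 0 < l →
            HasDerivAt (fun t => CrowdCMDP.value m γ d i (Function.update θ j t))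
              (θ i * CrowdCMDP.partialPenalty d i j θ) (θ j) ∧
            0 ≤ θ i * CrowdCMDP.partialPenalty d i j θ) := by
  open CrowdCMDP in
  have hderiv : ∀ x, 1 < x → HasDerivAt d (derivWithin d (Set.Ici 1) x) x := fun x hx =>
    (hd x hx.le).hasDerivWithinAt.hasDerivAt (Ici_mem_nhds hx)
  have hmono : StrictMonoOn d (Set.Ici 1) :=
    strictMonoOn_of_deriv_pos (convex_Ici 1) hd.continuousOn fun x hx => by
      rw [interior_Ici] at hx
      rw [(hderiv x hx).deriv]
      exact hd' x (le_of_lt hx)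
  have hprog := fun i => (m i).isConvexProgram hγ0 hγ1
  have hlevel : ∀ i, ∀ᵐ θ : Fin N → ℝ ∂MeasureTheory.volume,
      θ i ∉ Set.range fun q : ℚ => deriv (freeVal
        (fun π : (m i).Policy => LocalModel.discounted γ π (m i).utility)
        (fun π => LocalModel.K γ π)) q := fun i =>
    (LinearMap.proj i : (Fin N → ℝ) →ₗ[ℝ] ℝ).ae_notMem_of_countable _
      (fun h => by simpa using LinearMap.congr_fun h (fun _ => (1 : ℝ))) (Set.countable_range _)
  have hprice : ∀ i j : Fin N, ∀ᵐ θ : Fin N → ℝ ∂MeasureTheory.volume, j ≠ i → (∀ k, 0 < θ k) →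
      d (1 + others i θ) ∉ {z | ¬ DifferentiableAt ℝ (fun z => -freeVal
        (fun π : (m i).Policy => LocalModel.discounted γ π (m i).utility)
        (fun π => LocalModel.K γ π) z) z} := fun i j => by
    by_cases hij : j = i
    · exact .of_forall fun θ h => absurd hij h
    · filter_upwards [ae_penalty_notMem hmono
        (hprog i).convexOn_neg_freeVal.countable_not_differentiableAt hij] with θ hθ _
      exact hθ
  filter_upwards [MeasureTheory.ae_all_iff.2 hlevel, MeasureTheory.ae_all_iff.2 fun i =>
    MeasureTheory.ae_all_iff.2 (hprice i)] with θ hθ₁ hθ₂ hθ i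
  have hpos : ∀ k, 0 < θ k := fun k => (hθ k).1
  refine ⟨?_, exists_isOptimalMultiplier m d hγ0 hγ1 hM i θ (hpos i), fun π l hπ hl => ?_⟩
  · obtain ⟨π, h1, h2⟩ := (hprog i).exists_eq_optVal (hpos i).le (d (1 + others i θ))
    exact ⟨π, (isOptimalPolicy_iff m d hγ0 hγ1 i θ π).2
      ⟨h1, by rw [value_eq_optVal m d hγ0 hγ1, h2]⟩⟩
  obtain ⟨hK, hval⟩ := (isOptimalPolicy_iff m d hγ0 hγ1 i θ π).1 hπ
  obtain ⟨hl0, hdual⟩ := (isOptimalMultiplier_iff m d hγ0 hγ1 hM i θ (hpos i) l).1 hl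
  have hlM : 0 ≤ l / M := div_nonneg hl0 hM.le
  have hopt := hval
  rw [value_eq_optVal m d hγ0 hγ1] at hopt
  rw [dual_eq_freeVal m d hγ0 hγ1, value_eq_optVal m d hγ0 hγ1] at hdual
  have hslack := (hprog i).complementary hlM hK hopt hdual
  refine ⟨?_, ?_, ?_, fun j hij => ?_⟩
  · rw [hval, lagrangian, LocalModel.J_eq hγ0 hγ1]
    -- The Lagrangian differs from the value by the complementary slackness product.
    linear_combination -hslack
  · simp only [value_eq_optVal m d hγ0 hγ1, others_update_self, Function.update_self, neg_div]
    exact (hprog i).hasDerivAt_level (hpos i) (hθ₁ i) hlM hdual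
  · rw [neg_div]
    exact neg_nonpos.2 hlM
  · have hx : 1 < 1 + others i θ := lt_add_of_pos_right 1 (others_pos hij hpos)
    have hpen : HasDerivAt (fun t => d (1 + others i (Function.update θ j t)))
        (derivWithin d (Set.Ici 1) (1 + others i θ)) (θ j) := by
      have hin : HasDerivAt (fun t => 1 + others i (Function.update θ j t)) 1 (θ j) := by
        simp only [others_update_of_ne hij]
        exact (((hasDerivAt_id (θ j)).sub_const (θ j)).const_add (others i θ)).const_add 1
      have hout := hderiv _ hx
      rw [← Function.update_eq_self j θ] at hout
      have hcomp := hout.comp (θ j) hin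
      rw [mul_one, Function.update_eq_self] at hcomp
      exact hcomp
    have hpp : partialPenalty d i j θ = derivWithin d (Set.Ici 1) (1 + others i θ) := hpen.deriv
    have hpp0 : 0 ≤ partialPenalty d i j θ := by
      rw [hpp]
      exact (hd' _ hx.le).le
    have hmain : HasDerivAt (fun t => value m γ d i (Function.update θ j t))
        (LocalModel.K γ π * partialPenalty d i j θ) (θ j) := by
      simp only [value_eq_optVal m d hγ0 hγ1, Function.update_of_ne hij.symm]
      have hout := (hprog i).hasDerivAt_price (hpos i) (not_not.1 (hθ₂ i j hij hpos)) hlM hK hopt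
        hdual
      rw [hpp]
      have hcomp := hout.comp_of_eq (θ j) hpen (by rw [Function.update_eq_self])
      exact hcomp
    refine ⟨hmain, mul_nonneg ((hprog i).nonneg π) hpp0, fun hor => ?_⟩
    have hKθ : LocalModel.K γ π = θ i := by
      rcases hor with h | h
      · exact h
      · have := (mul_eq_zero.1 hslack).resolve_left (div_pos h hM).ne'
        linarith
    rw [← hKθ]
    exact ⟨hmain, mul_nonneg ((hprog i).nonneg π) hpp0⟩
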